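/- Let $X$ be a separable Banach space over $\mathbb{R}$ or $\mathbb{C}$ whose dual space $X^*$ is non-separable in its norm topology. Then for every $\delta > 0$ there exists a norm-closed linear subspace $Y \subseteq X$ such that $Y^*$ is non-separable and $Y$ has a (Schauder) basis $(e_n)_{n=0}^{\infty}$ with basis constant not exceeding $1+\delta$. Here the basis constant is $\sup_n \|P_n\|$, where $P_n : Y \to Y$ is the projection $\sum_{i=0}^\infty a_i e_i \mapsto \sum_{i<n} a_i e_i$. -/

import Mathlib

/-!
A non-separable dual contains an uncountable `ε`-separated bounded set `A`. Balls of the dual of a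
separable space are compact and metrizable in the weak-star topology, so `A` can be replaced by its
condensation points that belong to it; then each nonempty relatively open subset of `A` is
uncountable. Let `W n` run through the nonempty traces on `A` of a countable base. By the Baire
property of the weak-star closure of `A`, every countable weak-star closed cover has a member
containing some `W n`.

If all differences of elements of `W n` were at most `ε / 4` on the unit ball of the common kernel
of finitely many functionals, then by the Hahn–Banach theorem each such difference would be within
`ε / 4` of the span of these functionals. This span is separable, which is impossible as `W n` is
uncountable and `ε`-separated. Hence two elements of `W n` differ by more than `ε / 4` at some
vector `x n` of norm at most `1` in any prescribed closed subspace of finite codimension, and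
Mazur's construction allows the sequence `x` to be made basic with constant `1 + δ`. Let `Y` be its
closed span. If `Y*` were separable, then countably many small balls of `Y*` would cover it; their
preimages under restriction are weak-star closed, so the restrictions to `Y` of all functionals in
some `W n` would be close to each other, contrary to the choice of `x n`.
-/

open Filter Metric Set TopologicalSpace Topology
open scoped NNReal

section SeparatedSets

theorem exists_isSeparated_not_countable {α : Type*} [PseudoEMetricSpace α]
    (h : ¬ SeparableSpace α) :
    ∃ ε : ℝ≥0, 0 < ε ∧ ∃ A : Set α, IsSeparated ε A ∧ ¬ A.Countable := by
  by_contra! hcountable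
  suffices SecondCountableTopology α from h inferInstance
  refine EMetric.secondCountable_of_almost_dense_set fun r hr => ?_
  obtain ⟨ε, hε, hεr⟩ := ENNReal.lt_iff_exists_nnreal_btwn.1 hr
  obtain ⟨A, hA⟩ := zorn_subset {A : Set α | A ⊆ univ ∧ IsSeparated ε A} fun c hc hchain =>
    ⟨⋃₀ c, ⟨subset_univ _, (pairwise_sUnion hchain.directedOn).2 fun s hs => (hc hs).2⟩,
      fun s hs => subset_sUnion_of_mem hs⟩
  have hcover : univ ⊆ ⋃ y ∈ A, closedEBall y ε :=
    isCover_iff_subset_iUnion_closedEBall.1 (.of_maximal_isSeparated hA)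
  refine ⟨A, hcountable ε (mod_cast hε) A hA.prop.2, univ_subset_iff.1 (hcover.trans ?_)⟩
  exact iUnion₂_mono fun y _ => closedEBall_subset_closedEBall hεr.le

theorem countable_of_pairwise_le_dist {α E : Type*} [PseudoMetricSpace E] [SeparableSpace E]
    {s : Set α} {k : α → E} {r : ℝ} (hr : 0 < r)
    (h : s.Pairwise fun a b => r ≤ dist (k a) (k b)) : s.Countable := by
  have hdisj : s.PairwiseDisjoint fun a => ball (k a) (r / 2) := fun a ha b hb hab =>
    ball_disjoint_ball (by simpa using h ha hb hab)
  exact hdisj.countable_of_isOpen (fun _ _ => isOpen_ball)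
    fun a _ => nonempty_ball.2 (half_pos hr)

theorem exists_not_countable_inter_closedBall {α : Type*} [PseudoMetricSpace α] {A : Set α}
    (hA : ¬ A.Countable) (x : α) : ∃ N : ℕ, ¬ (A ∩ closedBall x N).Countable := by
  by_contra! h
  refine hA ?_
  rw [← inter_univ A, ← iUnion_closedBall_nat x, inter_iUnion]
  exact countable_iUnion h

end SeparatedSets

section CondensationPoints

variable {T : Type*} [TopologicalSpace T]

/-- The condensation points of `A`: the points all of whose neighbourhoods meet `A` in an
uncountable set. They need not belong to `A`. -/
def condensationPoints (A : Set T) : Set T :=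
  {x | ∀ U ∈ 𝓝 x, ¬ (A ∩ U).Countable}

theorem countable_sdiff_condensationPoints [SecondCountableTopology T] (A : Set T) :
    (A \ condensationPoints A).Countable := by
  have hnhds : ∀ x ∈ A \ condensationPoints A, ∃ U ∈ 𝓝 x, (A ∩ U).Countable := fun x hx => by
    simpa [condensationPoints] using hx.2
  choose! U hU hAU using hnhds
  obtain ⟨t, ht, htc, hcover⟩ :=
    countable_cover_nhdsWithin fun x hx => mem_nhdsWithin_of_mem_nhds (hU x hx)
  refine (htc.biUnion fun x hx => hAU x (ht hx)).mono fun y hy => ?_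
  obtain ⟨x, hx, hyx⟩ := mem_iUnion₂.1 (hcover hy)
  exact mem_iUnion₂.2 ⟨x, hx, hy.1, hyx⟩

theorem not_countable_inter_condensationPoints_inter [SecondCountableTopology T] {A V : Set T}
    (hV : IsOpen V) (hne : (condensationPoints A ∩ V).Nonempty) :
    ¬ (A ∩ condensationPoints A ∩ V).Countable := by
  obtain ⟨x, hx, hxV⟩ := hne
  intro hcountable
  refine hx V (hV.mem_nhds hxV)
    ((hcountable.union (countable_sdiff_condensationPoints A)).mono ?_)
  rintro y ⟨hyA, hyV⟩
  by_cases hy : y ∈ condensationPoints A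
  · exact Or.inl ⟨⟨hyA, hy⟩, hyV⟩
  · exact Or.inr ⟨hyA, hy⟩

theorem exists_isOpen_inter_subset_of_iUnion_closed [CompactSpace T] [R1Space T] {ι : Type*}
    [Countable ι] {A : Set T} (hA : A.Nonempty) {C : ι → Set T} (hC : ∀ j, IsClosed (C j))
    (hcover : ⋃ j, C j = univ) : ∃ j U, IsOpen U ∧ (A ∩ U).Nonempty ∧ A ∩ U ⊆ C j := by
  have : Nonempty (closure A) := hA.closure.to_subtype
  have : CompactSpace (closure A) := isCompact_iff_compactSpace.1 isClosed_closure.isCompact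
  obtain ⟨j, p, hp⟩ := nonempty_interior_of_iUnion_of_closed
    (f := fun j => ((↑) : closure A → T) ⁻¹' C j)
    (fun j => (hC j).preimage continuous_subtype_val)
    (by rw [← preimage_iUnion, hcover, preimage_univ])
  obtain ⟨_, hsub, ⟨U, hU, rfl⟩, hpU⟩ := mem_interior.1 hp
  obtain ⟨q, hqU, hqA⟩ := mem_closure_iff.1 p.2 U hU hpU
  exact ⟨j, U, hU, ⟨q, hqA, hqU⟩, fun r hr => hsub (a := ⟨r, subset_closure hr.1⟩) hr.2⟩

/-- The sequence `W` of sets detects closed covers if every countable closed cover of the space has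
a member containing some `W n` entirely. This is the form in which the Baire property enters. -/
def DetectsClosedCovers (W : ℕ → Set T) : Prop :=
  ∀ C : ℕ → Set T, (∀ j, IsClosed (C j)) → ⋃ j, C j = univ → ∃ n j, W n ⊆ C j

theorem DetectsClosedCovers.image {S : Type*} [TopologicalSpace S] {W : ℕ → Set S}
    (hW : DetectsClosedCovers W) {φ : S → T} (hφ : Continuous φ) :
    DetectsClosedCovers fun n => φ '' W n := by
  intro C hC hcover
  obtain ⟨n, j, hnj⟩ := hW (fun j => φ ⁻¹' C j) (fun j => (hC j).preimage hφ)
    (by rw [← preimage_iUnion, hcover, preimage_univ])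
  exact ⟨n, j, image_subset_iff.2 hnj⟩

theorem exists_detectsClosedCovers_not_countable [CompactSpace T] [R1Space T]
    [SecondCountableTopology T] {A : Set T} (hA : ¬ A.Countable) :
    ∃ W : ℕ → Set T, (∀ n, W n ⊆ A ∧ ¬ (W n).Countable) ∧ DetectsClosedCovers W := by
  set A' := A ∩ condensationPoints A
  have hA' : A'.Nonempty := nonempty_iff_ne_empty.2 fun hempty => hA <| by
    rw [← sdiff_eq_left.2 (disjoint_iff_inter_eq_empty.2 hempty)]
    exact countable_sdiff_condensationPoints A
  set 𝓥 : Set (Set T) := {V ∈ countableBasis T | (A' ∩ V).Nonempty}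
  have hsub : ∀ U, IsOpen U → (A' ∩ U).Nonempty → ∃ V ∈ 𝓥, V ⊆ U := by
    rintro U hU ⟨x, hxA, hxU⟩
    obtain ⟨V, hV, hxV, hVU⟩ := (isBasis_countableBasis T).exists_subset_of_mem_open hxU hU
    exact ⟨V, ⟨hV, x, hxA, hxV⟩, hVU⟩
  obtain ⟨V₀, hV₀, -⟩ := hsub univ isOpen_univ (by rwa [inter_univ])
  obtain ⟨V, hV⟩ := ((countable_countableBasis T).mono (sep_subset _ _) : 𝓥.Countable)
    |>.exists_eq_range ⟨V₀, hV₀⟩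
  have hV𝓥 : ∀ n, V n ∈ 𝓥 := fun n => hV ▸ mem_range_self n
  refine ⟨fun n => A' ∩ V n, fun n => ⟨inter_subset_left.trans inter_subset_left, ?_⟩, ?_⟩
  · exact not_countable_inter_condensationPoints_inter (isOpen_of_mem_countableBasis (hV𝓥 n).1)
      ((hV𝓥 n).2.mono (inter_subset_inter_left _ inter_subset_right))
  · intro C hC hcover
    obtain ⟨j, U, hU, hne, hUC⟩ := exists_isOpen_inter_subset_of_iUnion_closed hA' hC hcover
    obtain ⟨V', hV', hVU⟩ := hsub U hU hne
    obtain ⟨n, rfl⟩ := hV ▸ hV'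
    exact ⟨n, j, (inter_subset_inter_right _ hVU).trans hUC⟩

end CondensationPoints

section BasicSequences

/-- `x` is a basic sequence with basis constant at most `C`, in the form of Grunblum's criterion:
the partial sums of a finite linear combination of the `x i` have norm at most `C` times the norm
of the whole combination. -/
structure IsBasicSeq (𝕜 : Type*) {X : Type*} [NontriviallyNormedField 𝕜] [NormedAddCommGroup X]
    [NormedSpace 𝕜 X] (x : ℕ → X) (C : ℝ) : Prop where
  ne_zero : ∀ n, x n ≠ 0
  norm_sum_range_le : ∀ n (a : ℕ →₀ 𝕜),
    ‖∑ i ∈ Finset.range n, a i • x i‖ ≤ C * ‖Finsupp.linearCombination 𝕜 x a‖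

namespace IsBasicSeq

variable {𝕜 : Type*} [NontriviallyNormedField 𝕜]
  {X : Type*} [NormedAddCommGroup X] [NormedSpace 𝕜 X] {x : ℕ → X} {C : ℝ}

theorem of_forall_span (hx : ∀ n, x n ≠ 0)
    (h : ∀ n, ∀ y ∈ Submodule.span 𝕜 (x '' Iio n), ∀ z ∈ Submodule.span 𝕜 (x '' Ici n),
      ‖y‖ ≤ C * ‖y + z‖) : IsBasicSeq 𝕜 x C := by
  refine ⟨hx, fun n a => ?_⟩
  have hmem : ∀ {s : Set ℕ} (t : Finset ℕ), (∀ i ∈ t, i ∈ s) →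
      ∑ i ∈ t, a i • x i ∈ Submodule.span 𝕜 (x '' s) := fun t ht =>
    Submodule.sum_mem _ fun i hi =>
      Submodule.smul_mem _ _ (Submodule.subset_span (mem_image_of_mem x (ht i hi)))
  obtain ⟨N, hN⟩ := a.support.exists_nat_subset_range
  have hsplit : Finsupp.linearCombination 𝕜 x a =
      ∑ i ∈ Finset.range n, a i • x i + ∑ i ∈ Finset.Ico n (n + N), a i • x i := by
    rw [Finset.sum_range_add_sum_Ico _ (Nat.le_add_right n N)]
    exact Finsupp.sum_of_support_subset a
      (hN.trans (Finset.range_subset_range.2 (Nat.le_add_left N n))) _ (by simp)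
  rw [hsplit]
  exact h n _ (hmem _ fun i hi => Finset.mem_range.1 hi) _
    (hmem _ fun i hi => (Finset.mem_Ico.1 hi).1)

theorem of_comp_linearIsometry {Y : Type*} [NormedAddCommGroup Y] [NormedSpace 𝕜 Y]
    {y : ℕ → Y} (φ : Y →ₗᵢ[𝕜] X) (h : IsBasicSeq 𝕜 (φ ∘ y) C) : IsBasicSeq 𝕜 y C where
  ne_zero n hn := h.ne_zero n (by simp [hn])
  norm_sum_range_le n a := by
    have hlin : Finsupp.linearCombination 𝕜 (φ ∘ y) a = φ (Finsupp.linearCombination 𝕜 y a) :=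
      (Finsupp.apply_linearCombination 𝕜 φ.toLinearMap y a).symm
    have hsum : ∑ i ∈ Finset.range n, a i • (φ ∘ y) i = φ (∑ i ∈ Finset.range n, a i • y i) := by
      simp only [map_sum, map_smul, Function.comp_apply]
    simpa only [hlin, hsum, φ.norm_map] using h.norm_sum_range_le n a

theorem constant_nonneg (hx : IsBasicSeq 𝕜 x C) : 0 ≤ C := by
  have hle : ‖x 0‖ ≤ C * ‖x 0‖ := by simpa using hx.norm_sum_range_le 1 (Finsupp.single 0 1)
  exact nonneg_of_mul_nonneg_left ((norm_nonneg _).trans hle) (norm_pos_iff.2 (hx.ne_zero 0))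

theorem norm_coeff_le (hx : IsBasicSeq 𝕜 x C) (n : ℕ) (a : ℕ →₀ 𝕜) :
    ‖a n‖ ≤ 2 * C / ‖x n‖ * ‖Finsupp.linearCombination 𝕜 x a‖ := by
  rw [div_mul_eq_mul_div, le_div_iff₀ (norm_pos_iff.2 (hx.ne_zero n)), ← norm_smul]
  calc ‖a n • x n‖
      = ‖∑ i ∈ Finset.range (n + 1), a i • x i - ∑ i ∈ Finset.range n, a i • x i‖ := by
        rw [Finset.sum_range_succ, add_sub_cancel_left]
    _ ≤ C * ‖Finsupp.linearCombination 𝕜 x a‖ + C * ‖Finsupp.linearCombination 𝕜 x a‖ :=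
        norm_sub_le_of_le (hx.norm_sum_range_le (n + 1) a) (hx.norm_sum_range_le n a)
    _ = 2 * C * ‖Finsupp.linearCombination 𝕜 x a‖ := by ring

variable [CompleteSpace 𝕜]

variable (𝕜) in
/-- The `n`-th coordinate functional of a basic sequence `x` with dense span, extending
`∑ a i • x i ↦ a n` by continuity. It has the junk value `0` if that map is not bounded or
the span of `x` is not dense. -/
noncomputable def coord (x : ℕ → X) (n : ℕ) : StrongDual 𝕜 X :=
  (Finsupp.lapply (R := 𝕜) n).extendOfNorm (Finsupp.linearCombination 𝕜 x)

variable (𝕜) in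
/-- The `n`-th partial sum operator of a basic sequence `x` with dense span. -/
noncomputable def proj (x : ℕ → X) (n : ℕ) : X →L[𝕜] X :=
  ∑ i ∈ Finset.range n, (coord 𝕜 x i).smulRight (x i)

theorem proj_apply (n : ℕ) (y : X) :
    proj 𝕜 x n y = ∑ i ∈ Finset.range n, coord 𝕜 x i y • x i := by
  simp [proj]

theorem coord_linearCombination (hx : IsBasicSeq 𝕜 x C)
    (hd : DenseRange (Finsupp.linearCombination 𝕜 x)) (n : ℕ) (a : ℕ →₀ 𝕜) :
    coord 𝕜 x n (Finsupp.linearCombination 𝕜 x a) = a n :=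
  LinearMap.extendOfNorm_eq hd ⟨_, hx.norm_coeff_le n⟩ a

theorem coord_self (hx : IsBasicSeq 𝕜 x C) (hd : DenseRange (Finsupp.linearCombination 𝕜 x))
    (i j : ℕ) : coord 𝕜 x i (x j) = (Pi.single j 1 : ℕ → 𝕜) i := by
  simpa [Finsupp.single_eq_pi_single] using hx.coord_linearCombination hd i (Finsupp.single j 1)

theorem norm_proj_apply_le (hx : IsBasicSeq 𝕜 x C)
    (hd : DenseRange (Finsupp.linearCombination 𝕜 x)) (n : ℕ) (y : X) :
    ‖proj 𝕜 x n y‖ ≤ C * ‖y‖ := by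
  refine hd.induction_on y (isClosed_le (by fun_prop) (by fun_prop)) fun a => ?_
  simpa only [proj_apply, hx.coord_linearCombination hd] using hx.norm_sum_range_le n a

theorem proj_linearCombination_eventuallyEq (hx : IsBasicSeq 𝕜 x C)
    (hd : DenseRange (Finsupp.linearCombination 𝕜 x)) (a : ℕ →₀ 𝕜) :
    ∀ᶠ n in atTop, proj 𝕜 x n (Finsupp.linearCombination 𝕜 x a) =
      Finsupp.linearCombination 𝕜 x a := by
  obtain ⟨N, hN⟩ := a.support.exists_nat_subset_range
  filter_upwards [eventually_ge_atTop N] with n hn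
  simp only [proj_apply, hx.coord_linearCombination hd]
  exact (Finsupp.sum_of_support_subset a (hN.trans (Finset.range_subset_range.2 hn))
    (fun i c => c • x i) (by simp)).symm

theorem tendsto_proj (hx : IsBasicSeq 𝕜 x C) (hd : DenseRange (Finsupp.linearCombination 𝕜 x))
    (y : X) : Tendsto (fun n => proj 𝕜 x n y) atTop (𝓝 y) := by
  have hequi : Equicontinuous fun n => ⇑(proj 𝕜 x n) :=
    (LipschitzWith.uniformEquicontinuous _ C.toNNReal fun n =>
      AddMonoidHomClass.lipschitz_of_bound _ C (hx.norm_proj_apply_le hd n)).equicontinuous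
  refine hd.induction_on y (hequi.isClosed_setOfPred_tendsto continuous_id) fun a => ?_
  exact tendsto_const_nhds.congr' (EventuallyEq.symm (hx.proj_linearCombination_eventuallyEq hd a))

/-- The Schauder basis given by a basic sequence with dense span. -/
noncomputable def schauderBasis (hx : IsBasicSeq 𝕜 x C)
    (hd : DenseRange (Finsupp.linearCombination 𝕜 x)) : SchauderBasis 𝕜 X where
  basis := x
  coord := coord 𝕜 x
  ortho i j := by convert hx.coord_self hd i j
  expansion y := by
    rw [HasSum, SummationFilter.conditional_filter_eq_map_range, tendsto_map'_iff]
    exact (hx.tendsto_proj hd y).congr fun n => proj_apply n y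

theorem enormProjBound_schauderBasis_le (hx : IsBasicSeq 𝕜 x C)
    (hd : DenseRange (Finsupp.linearCombination 𝕜 x)) :
    (hx.schauderBasis hd).enormProjBound ≤ ENNReal.ofReal C := by
  refine iSup_le fun n => ?_
  have hproj : (hx.schauderBasis hd).proj n = proj 𝕜 x n := rfl
  rw [hproj, ← ofReal_norm]
  exact ENNReal.ofReal_le_ofReal
    (ContinuousLinearMap.opNorm_le_bound _ hx.constant_nonneg (hx.norm_proj_apply_le hd n))

theorem exists_schauderBasis_topologicalClosure_span (hx : IsBasicSeq 𝕜 x C) :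
    ∃ b : SchauderBasis 𝕜 (Submodule.span 𝕜 (range x)).topologicalClosure,
      b.enormProjBound ≤ ENNReal.ofReal C := by
  set Y := (Submodule.span 𝕜 (range x)).topologicalClosure
  let v : ℕ → Y := fun n =>
    ⟨x n, Submodule.le_topologicalClosure _ (Submodule.subset_span (mem_range_self n))⟩
  have hv : IsBasicSeq 𝕜 v C := of_comp_linearIsometry Y.subtypeₗᵢ hx
  have himage : Subtype.val '' range (Finsupp.linearCombination 𝕜 v) =
      (Submodule.span 𝕜 (range x) : Set X) := by
    rw [← LinearMap.coe_range, Finsupp.range_linearCombination, ← Submodule.coe_subtype,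
      ← Submodule.map_coe, Submodule.map_span, ← range_comp]
    rfl
  have hdense : DenseRange (Finsupp.linearCombination 𝕜 v) :=
    Subtype.dense_iff.2 (himage ▸ (Submodule.topologicalClosure_coe _).le)
  exact ⟨hv.schauderBasis hdense, hv.enormProjBound_schauderBasis_le hdense⟩

end IsBasicSeq

end BasicSequences

section AnnihilatorsOfFiniteSets

theorem mem_span_of_forall_eq_zero {𝕜 E : Type*} [Field 𝕜] [TopologicalSpace 𝕜]
    [IsTopologicalRing 𝕜] [AddCommGroup E] [TopologicalSpace E] [Module 𝕜 E]
    {S : Finset (StrongDual 𝕜 E)} {f : StrongDual 𝕜 E}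
    (hf : ∀ x, (∀ g ∈ S, g x = 0) → f x = 0) :
    f ∈ Submodule.span 𝕜 (S : Set (StrongDual 𝕜 E)) := by
  have hker : ⨅ g : S, LinearMap.ker (g.1 : E →ₗ[𝕜] 𝕜) ≤ LinearMap.ker (f : E →ₗ[𝕜] 𝕜) := by
    intro x hx
    refine hf x fun g hg => ?_
    exact (Submodule.mem_iInf _).1 hx ⟨g, hg⟩
  obtain ⟨c, hc⟩ := (Submodule.mem_span_range_iff_exists_fun 𝕜).1 (mem_span_of_iInf_ker_le_ker hker)
  have hsum : f = ∑ g : S, c g • g.1 :=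
    ContinuousLinearMap.coe_injective (by simpa using hc.symm)
  rw [hsum]
  exact Submodule.sum_mem _ fun g _ => Submodule.smul_mem _ _ (Submodule.subset_span g.2)

variable {𝕜 : Type*} [RCLike 𝕜] {E : Type*} [NormedAddCommGroup E] [NormedSpace 𝕜 E]

theorem exists_mem_span_norm_sub_le {S : Finset (StrongDual 𝕜 E)} {f : StrongDual 𝕜 E} {c : ℝ}
    (hf : ∀ x, ‖x‖ ≤ 1 → (∀ g ∈ S, g x = 0) → ‖f x‖ ≤ c) :
    ∃ k ∈ Submodule.span 𝕜 (S : Set (StrongDual 𝕜 E)), ‖f - k‖ ≤ c := by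
  have hc : 0 ≤ c := by simpa using hf 0
  set G : Submodule 𝕜 E := ⨅ g : S, LinearMap.ker (g.1 : E →ₗ[𝕜] 𝕜)
  have hG : ∀ x, x ∈ G ↔ ∀ g ∈ S, g x = 0 := fun x => by simp [G, Submodule.mem_iInf]
  obtain ⟨e, he, hnorm⟩ := exists_extension_norm_eq G (f.comp G.subtypeL)
  refine ⟨f - e, mem_span_of_forall_eq_zero fun x hx => ?_, ?_⟩
  · simpa [sub_eq_zero] using (he ⟨x, (hG x).2 hx⟩).symm
  · rw [sub_sub_cancel, hnorm]
    exact ContinuousLinearMap.opNorm_le_of_unit_norm (𝕜 := 𝕜) hc fun x hx =>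
      hf x hx.le ((hG x).1 x.2)

theorem exists_norm_le_one_forall_eq_zero_lt_norm_sub (S : Finset (StrongDual 𝕜 E))
    {W : Set (StrongDual 𝕜 E)} (hW : ¬ W.Countable) {ε : ℝ≥0} (hsep : IsSeparated ε W) {c : ℝ}
    (hc : 2 * c < ε) :
    ∃ x : E, ‖x‖ ≤ 1 ∧ (∀ g ∈ S, g x = 0) ∧ ∃ f ∈ W, ∃ f' ∈ W, c < ‖f x - f' x‖ := by
  by_contra! h
  obtain ⟨f₀, hf₀⟩ : W.Nonempty := nonempty_iff_ne_empty.2 fun hW' => hW (hW' ▸ countable_empty)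
  set F : Submodule 𝕜 (StrongDual 𝕜 E) := Submodule.span 𝕜 S
  have : FiniteDimensional 𝕜 F := FiniteDimensional.span_finset 𝕜 S
  have : ProperSpace F := FiniteDimensional.proper 𝕜 F
  have hnear : ∀ f ∈ W, ∃ k : F, ‖f - f₀ - k‖ ≤ c := fun f hf =>
    let ⟨k, hk, hkc⟩ := exists_mem_span_norm_sub_le fun x hx hxS => h x hx hxS f hf f₀ hf₀
    ⟨⟨k, hk⟩, hkc⟩
  choose! k hk using hnear
  refine hW (countable_of_pairwise_le_dist (k := k) (sub_pos.2 hc) fun f hf f' hf' hne => ?_)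
  have hlt : (ε : ENNReal) < edist f f' := hsep hf hf' hne
  rw [edist_nndist, ENNReal.coe_lt_coe, ← NNReal.coe_lt_coe, coe_nndist, dist_eq_norm] at hlt
  have htri : ‖f - f'‖ ≤ c + dist (k f) (k f') + c := by
    rw [Subtype.dist_eq, dist_eq_norm]
    calc ‖f - f'‖
        = ‖(f - f₀ - k f) + (↑(k f) - ↑(k f')) - (f' - f₀ - k f')‖ := by congr 1; abel
      _ ≤ _ := norm_sub_le_of_le (norm_add_le_of_le (hk f hf) le_rfl) (hk f' hf')
  linarith

end AnnihilatorsOfFiniteSets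

section Mazur

variable {𝕜 : Type*} [RCLike 𝕜] {X : Type*} [NormedAddCommGroup X] [NormedSpace 𝕜 X]

theorem exists_finset_dual_forall_norm_le_add {K : Set X} (hK : IsCompact K) {r : ℝ}
    (hr : 0 < r) :
    ∃ S : Finset (StrongDual 𝕜 X), (∀ g ∈ S, ‖g‖ ≤ 1) ∧ ∀ u ∈ K, ∃ g ∈ S, ‖u‖ < ‖g u‖ + r := by
  classical
  choose φ hφ hφx using exists_dual_vector'' (E := X) 𝕜
  obtain ⟨t, -, ht⟩ := hK.elim_nhds_subcover (fun x => {u | ‖u‖ < ‖φ x u‖ + r}) fun x _ =>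
    (isOpen_lt (by fun_prop) (by fun_prop)).mem_nhds (by simpa [hφx] using hr)
  refine ⟨t.image φ, Finset.forall_mem_image.2 fun x _ => hφ x, fun u hu => ?_⟩
  obtain ⟨x, hx, hxu⟩ := mem_iUnion₂.1 (ht hu)
  exact ⟨φ x, Finset.mem_image_of_mem φ hx, hxu⟩

theorem exists_finset_dual_forall_norm_le_mul (F : Submodule 𝕜 X) [FiniteDimensional 𝕜 F]
    {C : ℝ} (hC : 1 < C) :
    ∃ S : Finset (StrongDual 𝕜 X), (∀ g ∈ S, ‖g‖ ≤ 1) ∧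
      ∀ y ∈ F, y ≠ 0 → ∃ g ∈ S, ‖y‖ ≤ C * ‖g y‖ := by
  have hC0 : 0 < C := one_pos.trans hC
  have : ProperSpace F := FiniteDimensional.proper 𝕜 F
  obtain ⟨S, hS, hle⟩ := exists_finset_dual_forall_norm_le_add (𝕜 := 𝕜)
    ((isCompact_sphere (0 : F) 1).image continuous_subtype_val)
    (sub_pos.2 (inv_lt_one_of_one_lt₀ hC))
  refine ⟨S, hS, fun y hy hy0 => ?_⟩
  have hunit : ‖((‖y‖⁻¹ : ℝ) : 𝕜) • y‖ = 1 := by simp [norm_smul, hy0]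
  obtain ⟨g, hg, hlt⟩ := hle (((‖y‖⁻¹ : ℝ) : 𝕜) • y)
    ⟨⟨_, F.smul_mem _ hy⟩, mem_sphere_zero_iff_norm.2 hunit, rfl⟩
  refine ⟨g, hg, ?_⟩
  have hgu : ‖g (((‖y‖⁻¹ : ℝ) : 𝕜) • y)‖ = ‖g y‖ / ‖y‖ := by
    simp [inv_mul_eq_div]
  have hinv : C⁻¹ ≤ ‖g y‖ / ‖y‖ := by linarith
  rwa [le_div_iff₀ (norm_pos_iff.2 hy0), inv_mul_le_iff₀ hC0] at hinv

/-- Mazur's lemma for the construction of basic sequences. -/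
theorem exists_finset_dual_forall_norm_le_mul_norm_add (F : Submodule 𝕜 X)
    [FiniteDimensional 𝕜 F] {C : ℝ} (hC : 1 < C) :
    ∃ S : Finset (StrongDual 𝕜 X), ∀ y ∈ F, ∀ z, (∀ g ∈ S, g z = 0) → ‖y‖ ≤ C * ‖y + z‖ := by
  obtain ⟨S, hS, hle⟩ := exists_finset_dual_forall_norm_le_mul F hC
  refine ⟨S, fun y hy z hz => ?_⟩
  rcases eq_or_ne y 0 with rfl | hy0
  · rw [norm_zero]; positivity
  obtain ⟨g, hg, hyg⟩ := hle y hy hy0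
  calc ‖y‖ ≤ C * ‖g y‖ := hyg
    _ = C * ‖g (y + z)‖ := by rw [map_add, hz g hg, add_zero]
    _ ≤ C * ‖y + z‖ := by
      gcongr
      simpa using g.le_of_opNorm_le (hS g hg) (y + z)

end Mazur

section Selection

theorem exists_seq_forall_image_range {α : Type*} [DecidableEq α] {R : ℕ → Finset α → α → Prop}
    (h : ∀ n L, ∃ x, R n L x) : ∃ x : ℕ → α, ∀ n, R n ((Finset.range n).image x) (x n) := by
  choose next hnext using h
  let H : ℕ → Finset α := fun n => Nat.rec ∅ (fun n L => insert (next n L) L) n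
  have hH : ∀ n, (Finset.range n).image (fun k => next k (H k)) = H n := fun n => by
    induction n with
    | zero => rfl
    | succ n ih => rw [Finset.range_add_one, Finset.image_insert, ih]
  exact ⟨fun n => next n (H n), fun n => hH n ▸ hnext n (H n)⟩

variable {𝕜 : Type*} [RCLike 𝕜] {X : Type*} [NormedAddCommGroup X] [NormedSpace 𝕜 X]

theorem exists_isBasicSeq {A : ℕ → Set X} (hA0 : ∀ n, 0 ∉ A n)
    (hA : ∀ n (S : Finset (StrongDual 𝕜 X)), ∃ x ∈ A n, ∀ g ∈ S, g x = 0) {C : ℝ} (hC : 1 < C) :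
    ∃ x : ℕ → X, IsBasicSeq 𝕜 x C ∧ ∀ n, x n ∈ A n := by
  classical
  choose S hS using fun L : Finset X =>
    have := FiniteDimensional.span_finset 𝕜 L
    exists_finset_dual_forall_norm_le_mul_norm_add (Submodule.span 𝕜 (L : Set X)) hC
  obtain ⟨x, hx⟩ := exists_seq_forall_image_range fun n (L : Finset X) =>
    hA n (L.powerset.biUnion S)
  refine ⟨x, .of_forall_span (fun n h0 => hA0 n (h0 ▸ (hx n).1)) fun n y hy z hz => ?_,
    fun n => (hx n).1⟩
  have hzS : ∀ g ∈ S ((Finset.range n).image x), g z = 0 := fun g hg => by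
    refine (Submodule.span_le (p := LinearMap.ker (g : X →ₗ[𝕜] 𝕜))).2 ?_ hz
    rintro _ ⟨i, hi, rfl⟩
    exact (hx i).2 g (Finset.mem_biUnion.2 ⟨_, Finset.mem_powerset.2
      (Finset.image_subset_image (Finset.range_subset_range.2 hi)), hg⟩)
  exact hS _ y (by simpa using hy) z hzS

theorem exists_isBasicSeq_forall_lt_norm_sub {W : ℕ → Set (StrongDual 𝕜 X)}
    (hW : ∀ n, ¬ (W n).Countable) {ε : ℝ≥0} (hsep : ∀ n, IsSeparated ε (W n)) {c C : ℝ}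
    (hc : 0 ≤ c) (hcε : 2 * c < ε) (hC : 1 < C) :
    ∃ x : ℕ → X, IsBasicSeq 𝕜 x C ∧
      ∀ n, ‖x n‖ ≤ 1 ∧ ∃ f ∈ W n, ∃ f' ∈ W n, c < ‖f (x n) - f' (x n)‖ := by
  refine exists_isBasicSeq
    (A := fun n => {x | ‖x‖ ≤ 1 ∧ ∃ f ∈ W n, ∃ f' ∈ W n, c < ‖f x - f' x‖}) ?_ (fun n S => ?_) hC
  · rintro n ⟨-, f, -, f', -, hlt⟩
    simp only [map_zero, sub_zero, norm_zero] at hlt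
    exact hlt.not_ge hc
  · obtain ⟨x, hx, hxS, hxW⟩ :=
      exists_norm_le_one_forall_eq_zero_lt_norm_sub S (hW n) (hsep n) hcε
    exact ⟨x, ⟨hx, hxW⟩, hxS⟩

end Selection

section WeakStarTopology

variable {𝕜 : Type*} [NontriviallyNormedField 𝕜]
  {X : Type*} [NormedAddCommGroup X] [NormedSpace 𝕜 X]

theorem exists_subset_detectsClosedCovers_toWeakDual [ProperSpace 𝕜] [SeparableSpace X]
    {A : Set (StrongDual 𝕜 X)} (hA : ¬ A.Countable) :
    ∃ W : ℕ → Set (StrongDual 𝕜 X), (∀ n, W n ⊆ A ∧ ¬ (W n).Countable) ∧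
      DetectsClosedCovers fun n => StrongDual.toWeakDual '' W n := by
  obtain ⟨N, hN⟩ := exists_not_countable_inter_closedBall hA 0
  set K : Set (WeakDual 𝕜 X) := WeakDual.toStrongDual ⁻¹' closedBall 0 (N : ℝ)
  have hK : IsCompact K := WeakDual.isCompact_closedBall 0 (N : ℝ)
  have : CompactSpace K := isCompact_iff_compactSpace.1 hK
  have : MetrizableSpace K := WeakDual.metrizable_of_isCompact 𝕜 X K hK
  let _ := metrizableSpaceMetric K
  let ι : K → StrongDual 𝕜 X := fun f => WeakDual.toStrongDual f.1
  have himage : A ∩ closedBall 0 N ⊆ ι '' (ι ⁻¹' A) := fun f hf =>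
    ⟨⟨StrongDual.toWeakDual f, hf.2⟩, hf.1, rfl⟩
  have hpre : ¬ (ι ⁻¹' A).Countable := fun hcountable => hN ((hcountable.image ι).mono himage)
  obtain ⟨W, hW, hdetect⟩ := exists_detectsClosedCovers_not_countable hpre
  refine ⟨fun n => ι '' W n, fun n => ⟨image_subset_iff.2 (hW n).1, fun hcountable => ?_⟩, ?_⟩
  · have hι : ι.Injective := WeakDual.toStrongDual.injective.comp Subtype.val_injective
    exact (hW n).2 (countable_of_injective_of_countable_image hι.injOn hcountable)
  · simp only [image_image]
    exact hdetect.image continuous_subtype_val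

variable {Y : Type*} [NormedAddCommGroup Y] [NormedSpace 𝕜 Y]

theorem isClosed_setOf_norm_comp_sub_le (φ : Y →L[𝕜] X) (d : StrongDual 𝕜 Y) {r : ℝ}
    (hr : 0 ≤ r) :
    IsClosed {f : WeakDual 𝕜 X | ‖(WeakDual.toStrongDual f).comp φ - d‖ ≤ r} := by
  simp only [ContinuousLinearMap.opNorm_le_iff hr, ofPred_forall]
  exact isClosed_iInter fun y => isClosed_le
    ((WeakDual.eval_continuous (φ y)).sub continuous_const).norm continuous_const

theorem DetectsClosedCovers.exists_forall_norm_comp_sub_le [SeparableSpace (StrongDual 𝕜 Y)]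
    {W : ℕ → Set (StrongDual 𝕜 X)}
    (hW : DetectsClosedCovers fun n => StrongDual.toWeakDual '' W n) (φ : Y →L[𝕜] X) {r : ℝ}
    (hr : 0 < r) : ∃ n, ∃ d : StrongDual 𝕜 Y, ∀ f ∈ W n, ‖f.comp φ - d‖ ≤ r := by
  obtain ⟨n, j, hnj⟩ := hW
    (fun j => {f | ‖(WeakDual.toStrongDual f).comp φ - denseSeq (StrongDual 𝕜 Y) j‖ ≤ r})
    (fun j => isClosed_setOf_norm_comp_sub_le φ _ hr.le)
    (eq_univ_of_forall fun f => by
      obtain ⟨j, hj⟩ := (denseRange_denseSeq (StrongDual 𝕜 Y)).exists_dist_lt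
        ((WeakDual.toStrongDual f).comp φ) hr
      exact mem_iUnion.2 ⟨j, (dist_eq_norm _ (denseSeq (StrongDual 𝕜 Y) j) ▸ hj).le⟩)
  exact ⟨n, _, fun f hf => hnj (mem_image_of_mem _ hf)⟩

theorem DetectsClosedCovers.not_separableSpace_of_forall_exists_lt {W : ℕ → Set (StrongDual 𝕜 X)}
    (hW : DetectsClosedCovers fun n => StrongDual.toWeakDual '' W n) (φ : Y →L[𝕜] X) {c : ℝ}
    (hc : 0 < c)
    (h : ∀ n, ∃ y, ‖y‖ ≤ 1 ∧ ∃ f ∈ W n, ∃ f' ∈ W n, c < ‖f (φ y) - f' (φ y)‖) :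
    ¬ SeparableSpace (StrongDual 𝕜 Y) := by
  intro hY
  obtain ⟨n, d, hd⟩ := hW.exists_forall_norm_comp_sub_le φ (half_pos hc)
  obtain ⟨y, hy, f, hf, f', hf', hlt⟩ := h n
  have hdist : ∀ g ∈ W n, ‖g (φ y) - d y‖ ≤ c / 2 := fun g hg =>
    (ContinuousLinearMap.le_of_opNorm_le _ (hd g hg) y).trans
      (mul_le_of_le_one_right (half_pos hc).le hy)
  refine hlt.not_ge ?_
  calc ‖f (φ y) - f' (φ y)‖ = ‖(f (φ y) - d y) - (f' (φ y) - d y)‖ := by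
        rw [sub_sub_sub_cancel_right]
    _ ≤ c / 2 + c / 2 := norm_sub_le_of_le (hdist f hf) (hdist f' hf')
    _ = c := add_halves c

end WeakStarTopology

theorem mainTheorem6_general {𝕜 : Type*} [RCLike 𝕜]
    {X : Type*} [NormedAddCommGroup X] [NormedSpace 𝕜 X] [SeparableSpace X]
    (hX : ¬ SeparableSpace (StrongDual 𝕜 X)) (δ : ℝ) (hδ : 0 < δ) :
    ∃ Y : Submodule 𝕜 X, IsClosed (Y : Set X) ∧ ¬ SeparableSpace (StrongDual 𝕜 Y) ∧
      ∃ b : SchauderBasis 𝕜 Y, b.enormProjBound ≤ ENNReal.ofReal (1 + δ) := by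
  obtain ⟨ε, hε, A, hAsep, hA⟩ := exists_isSeparated_not_countable hX
  obtain ⟨W, hW, hdetect⟩ := exists_subset_detectsClosedCovers_toWeakDual hA
  obtain ⟨x, hbasic, hx⟩ := exists_isBasicSeq_forall_lt_norm_sub (c := ε / 4)
    (fun n => (hW n).2) (fun n => hAsep.mono (hW n).1) (by positivity)
    (by linarith [NNReal.coe_pos.2 hε]) (lt_add_of_pos_right 1 hδ)
  refine ⟨(Submodule.span 𝕜 (range x)).topologicalClosure,
    Submodule.isClosed_topologicalClosure _, ?_,
    hbasic.exists_schauderBasis_topologicalClosure_span⟩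
  have hxY : ∀ n, x n ∈ (Submodule.span 𝕜 (range x)).topologicalClosure := fun n =>
    Submodule.le_topologicalClosure _ (Submodule.subset_span (mem_range_self n))
  exact hdetect.not_separableSpace_of_forall_exists_lt (Submodule.subtypeL _)
    (c := ε / 4) (by positivity) fun n => ⟨⟨x n, hxY n⟩, hx n⟩

theorem mainTheorem6 {𝕜 : Type*} [RCLike 𝕜]
    {X : Type*} [NormedAddCommGroup X] [NormedSpace 𝕜 X] [CompleteSpace X]
    [TopologicalSpace.SeparableSpace X]
    (hX : ¬ TopologicalSpace.SeparableSpace (StrongDual 𝕜 X))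
    (δ : ℝ) (hδ : 0 < δ) :
    ∃ Y : Submodule 𝕜 X, IsClosed (Y : Set X) ∧
      ¬ TopologicalSpace.SeparableSpace (StrongDual 𝕜 Y) ∧
      ∃ b : SchauderBasis 𝕜 Y, b.enormProjBound ≤ ENNReal.ofReal (1 + δ) :=
  mainTheorem6_general hX δ hδ
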